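/- Let $H$ and $K$ be complex Hilbert spaces, let $A$ be a bounded self-adjoint operator on $H$ and let $B$ be a bounded self-adjoint operator on $K$, with spectra $\Sigma(A), \Sigma(B) \subset \mathbf R$. Let $H \otimes K$ denote the Hilbert space tensor product, that is, the completion of the algebraic tensor product with respect to the inner product determined by $\langle x \otimes y, x' \otimes y' \rangle = \langle x, x' \rangle \langle y, y' \rangle$, and, for bounded operators $S$ on $H$ and $T$ on $K$, let $S \otimes T$ denote the bounded operator on $H \otimes K$ determined by $(S \otimes T)(x \otimes y) = Sx \otimes Ty$. Then: (i) the spectrum of $A \otimes \mathrm{id}_K + \mathrm{id}_H \otimes B$ is $\{ z \in \mathbf R \mid z = x + y \text{ for some } x \in \Sigma(A) \text{ and } y \in \Sigma(B) \}$; (ii) the spectrum of $A \otimes B$ is $\{ z \in \mathbf R \mid z = xy \text{ for some } x \in \Sigma(A) \text{ and } y \in \Sigma(B) \}$; (iii) the spectrum of $A \otimes \mathrm{id}_K + \mathrm{id}_H \otimes B + A \otimes B$ is $\{ z \in \mathbf R \mid z = x + y + xy \text{ for some } x \in \Sigma(A) \text{ and } y \in \Sigma(B) \}$. -/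

import Mathlib

open scoped TensorProduct

noncomputable section

/-- The Hilbert tensor product of two complex Hilbert spaces: the completion of the algebraic
tensor product for the inner product `⟪x ⊗ y, x' ⊗ y'⟫ = ⟪x, x'⟫ * ⟪y, y'⟫`. -/
abbrev HilbertTensor (H K : Type*) [NormedAddCommGroup H] [InnerProductSpace ℂ H]
    [NormedAddCommGroup K] [InnerProductSpace ℂ K] : Type _ :=
  UniformSpace.Completion (H ⊗[ℂ] K)

/-- The bounded operator `A ⊗ B` on the Hilbert tensor product: the continuous extension of
the map `x ⊗ y ↦ A x ⊗ B y` from the algebraic tensor product to its completion. -/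
def tensorOp {H K : Type*} [NormedAddCommGroup H] [InnerProductSpace ℂ H]
    [NormedAddCommGroup K] [InnerProductSpace ℂ K] (A : H →L[ℂ] H) (B : K →L[ℂ] K) :
    HilbertTensor H K →L[ℂ] HilbertTensor H K :=
  (TensorProduct.mapL A B).completion

theorem tensorOp_coe_tmul {H K : Type*} [NormedAddCommGroup H] [InnerProductSpace ℂ H]
    [NormedAddCommGroup K] [InnerProductSpace ℂ K] (A : H →L[ℂ] H) (B : K →L[ℂ] K)
    (x : H) (y : K) :
    tensorOp A B ((x ⊗ₜ[ℂ] y : H ⊗[ℂ] K) : HilbertTensor H K) =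
      ((A x ⊗ₜ[ℂ] B y : H ⊗[ℂ] K) : HilbertTensor H K) := by
  simp [tensorOp]

end

/-!
For commuting `a`, `b` in a complex Banach algebra, Gelfand theory of the bicommutant of `{a, b}`
gives `spectrum (f (a, b)) = f (jointSpectrum a b)` for every polynomial `f`. It remains to see that
the joint spectrum of `A ⊗ 1` and `1 ⊗ B` is the whole product of the two spectra. If `A - x` and
`B - y` are not invertible, there are nonzero `u`, `v` such that `A - x` or its adjoint is small at
`u`, relative to the norm of `u`, and `B - y` or its adjoint is small at `v`. The vector functional
of `u ⊗ v` then almost vanishes on `((A - x) ⊗ 1) X` and on `(1 ⊗ (B - y)) Y` for all `X`, `Y`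
commuting with `(A - x) ⊗ 1` and `1 ⊗ (B - y)`, respectively: move the small factor next to `u ⊗ v`,
on the right by commutation or on the left by taking the adjoint. Such operators therefore cannot
add up to `1`.
-/

open Polynomial

section Bicommutant

variable {𝕜 R : Type*} [CommRing 𝕜] [Ring R] [Algebra 𝕜 R]

theorem isUnit_coe_centralizer_iff {s : Set R} {c : Subalgebra.centralizer 𝕜 s} :
    IsUnit (c : R) ↔ IsUnit c := by
  refine ⟨?_, fun hc => hc.map (Subalgebra.centralizer 𝕜 s).val⟩
  rintro ⟨u, hu⟩
  have hinv : (↑u⁻¹ : R) ∈ Subalgebra.centralizer 𝕜 s := fun g hg =>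
    (show Commute g u from hu ▸ c.2 g hg).units_inv_right
  exact ⟨⟨c, ⟨_, hinv⟩, Subtype.ext (by simp [← hu]), Subtype.ext (by simp [← hu])⟩, rfl⟩

theorem spectrum_coe_centralizer {s : Set R} (c : Subalgebra.centralizer 𝕜 s) :
    spectrum 𝕜 (c : R) = spectrum 𝕜 c := by
  ext z
  simp only [spectrum.mem_iff, ← isUnit_coe_centralizer_iff]
  rfl

variable (𝕜) in
/-- The bicommutant of a set `s`: the subalgebra of all elements that commute with every element
commuting with `s`. When `s` is commutative it is a commutative subalgebra containing `s` in which
invertibility and spectra are the same as in the ambient algebra. -/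
abbrev bicommutant (s : Set R) : Subalgebra 𝕜 R :=
  Subalgebra.centralizer 𝕜 s.centralizer

theorem left_mem_bicommutant (a b : R) : a ∈ bicommutant 𝕜 {a, b} :=
  Set.subset_centralizer_centralizer (Set.mem_insert a {b})

theorem right_mem_bicommutant (a b : R) : b ∈ bicommutant 𝕜 {a, b} :=
  Set.subset_centralizer_centralizer (Set.mem_insert_of_mem a rfl)

theorem commute_left_of_mem_bicommutant {a b c : R} (hab : Commute a b)
    (hc : c ∈ bicommutant 𝕜 {a, b}) : Commute a c := by
  refine hc a ?_
  rintro _ (rfl | rfl)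
  exacts [rfl, hab.symm]

theorem commute_right_of_mem_bicommutant {a b c : R} (hab : Commute a b)
    (hc : c ∈ bicommutant 𝕜 {a, b}) : Commute b c := by
  refine hc b ?_
  rintro _ (rfl | rfl)
  exacts [hab, rfl]

variable (𝕜) in
/-- The joint spectrum of `a` and `b` relative to their bicommutant: the pairs `(x, y)` for which
`a - x` and `b - y` do not generate the unit ideal of the bicommutant. -/
def jointSpectrum (a b : R) : Set (𝕜 × 𝕜) :=
  {z | ∀ c ∈ bicommutant 𝕜 {a, b}, ∀ d ∈ bicommutant 𝕜 {a, b},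
    (a - algebraMap 𝕜 R z.1) * c + (b - algebraMap 𝕜 R z.2) * d ≠ 1}

theorem exists_mem_centralizer_sub_algebraMap_mul_eq_one {s : Set R} {a : R}
    (ha : a ∈ Subalgebra.centralizer 𝕜 s) {x : 𝕜} (hx : x ∉ spectrum 𝕜 a) :
    ∃ c ∈ Subalgebra.centralizer 𝕜 s, (a - algebraMap 𝕜 R x) * c = 1 := by
  lift a to Subalgebra.centralizer 𝕜 s using ha
  rw [spectrum_coe_centralizer, spectrum.notMem_iff, ← IsUnit.neg_iff, neg_sub] at hx
  obtain ⟨c, hc⟩ := hx.exists_right_inv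
  exact ⟨c, c.2, congrArg Subtype.val hc⟩

theorem jointSpectrum_subset_prod (a b : R) :
    jointSpectrum 𝕜 a b ⊆ spectrum 𝕜 a ×ˢ spectrum 𝕜 b := by
  rintro ⟨x, y⟩ hxy
  constructor
  · by_contra hx
    obtain ⟨c, hc, h⟩ :=
      exists_mem_centralizer_sub_algebraMap_mul_eq_one (left_mem_bicommutant a b) hx
    exact hxy c hc 0 (zero_mem _) (by simpa using h)
  · by_contra hy
    obtain ⟨d, hd, h⟩ :=
      exists_mem_centralizer_sub_algebraMap_mul_eq_one (right_mem_bicommutant a b) hy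
    exact hxy 0 (zero_mem _) d hd (by simpa using h)

end Bicommutant

section BanachAlgebra

theorem exists_algHom_forall_eq_zero {S : Type*} [NormedCommRing S] [NormedAlgebra ℂ S]
    [CompleteSpace S] {I : Ideal S} (hI : I ≠ ⊤) : ∃ φ : S →ₐ[ℂ] ℂ, ∀ c ∈ I, φ c = 0 := by
  obtain ⟨M, hM, hIM⟩ := I.exists_le_maximal hI
  exact ⟨WeakDual.CharacterSpace.toAlgHom M.toCharacterSpace,
    fun c hc => M.toCharacterSpace_apply_eq_zero_of_mem (hIM hc)⟩

variable {R : Type*} [NormedRing R] [NormedAlgebra ℂ R]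

/-- The normed commutative ring structure on the bicommutant of two commuting elements. It depends
on the proof `hab`, so it is a definition to be introduced locally and not an instance. -/
abbrev bicommutantNormedCommRing {a b : R} (hab : Commute a b) :
    NormedCommRing (bicommutant ℂ {a, b}) where
  __ := (inferInstance : NormedRing (bicommutant ℂ {a, b}))
  mul_comm c d := by
    have hcomm : ∀ x ∈ ({a, b} : Set R), ∀ y ∈ ({a, b} : Set R), x * y = y * x := by
      rintro _ (rfl | rfl) _ (rfl | rfl)
      exacts [rfl, hab, hab.symm, rfl]
    exact Subtype.ext (Set.centralizer_centralizer_comm_of_comm hcomm c c.2 d d.2)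

variable [CompleteSpace R] {a b : R}

instance completeSpace_bicommutant (s : Set R) : CompleteSpace (bicommutant ℂ s) :=
  (Set.isClosed_centralizer s.centralizer).completeSpace_coe

theorem mem_spectrum_coe_bicommutant_iff (hab : Commute a b) (c : bicommutant ℂ {a, b}) {z : ℂ} :
    z ∈ spectrum ℂ (c : R) ↔ ∃ φ : bicommutant ℂ {a, b} →ₐ[ℂ] ℂ, φ c = z := by
  let _ := bicommutantNormedCommRing hab
  rw [spectrum_coe_centralizer, WeakDual.CharacterSpace.mem_spectrum_iff_exists]
  exact WeakDual.CharacterSpace.equivAlgHom.exists_congr_left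

theorem mem_jointSpectrum_iff (hab : Commute a b) {x y : ℂ} :
    (x, y) ∈ jointSpectrum ℂ a b ↔ ∃ φ : bicommutant ℂ {a, b} →ₐ[ℂ] ℂ,
      φ ⟨a, left_mem_bicommutant a b⟩ = x ∧ φ ⟨b, right_mem_bicommutant a b⟩ = y := by
  let _ := bicommutantNormedCommRing hab
  set a' : bicommutant ℂ {a, b} := ⟨a, left_mem_bicommutant a b⟩
  set b' : bicommutant ℂ {a, b} := ⟨b, right_mem_bicommutant a b⟩
  constructor
  · intro hxy
    have hI : Ideal.span {a' - algebraMap ℂ _ x, b' - algebraMap ℂ _ y} ≠ ⊤ := by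
      rw [Ideal.ne_top_iff_one, Ideal.mem_span_pair]
      rintro ⟨c, d, h⟩
      refine hxy c c.2 d d.2 ?_
      rw [mul_comm c, mul_comm d] at h
      exact congrArg Subtype.val h
    obtain ⟨φ, hφ⟩ := exists_algHom_forall_eq_zero hI
    have ha := hφ _ (Ideal.subset_span (Set.mem_insert _ _))
    have hb := hφ _ (Ideal.subset_span (Set.mem_insert_of_mem _ rfl))
    exact ⟨φ, by simpa [sub_eq_zero] using ha, by simpa [sub_eq_zero] using hb⟩
  · rintro ⟨φ, rfl, rfl⟩ c hc d hd h
    have h' : (a' - algebraMap ℂ _ (φ a')) * ⟨c, hc⟩ + (b' - algebraMap ℂ _ (φ b')) * ⟨d, hd⟩ = 1 :=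
      Subtype.ext h
    simpa using congrArg φ h'

theorem spectrum_sum_aeval_mul_aeval (hab : Commute a b) {ι : Type*} (s : Finset ι)
    (p q : ι → ℂ[X]) :
    spectrum ℂ (∑ i ∈ s, aeval a (p i) * aeval b (q i)) =
      (fun z : ℂ × ℂ => ∑ i ∈ s, (p i).eval z.1 * (q i).eval z.2) '' jointSpectrum ℂ a b := by
  set a' : bicommutant ℂ {a, b} := ⟨a, left_mem_bicommutant a b⟩
  set b' : bicommutant ℂ {a, b} := ⟨b, right_mem_bicommutant a b⟩
  set c : bicommutant ℂ {a, b} := ∑ i ∈ s, aeval a' (p i) * aeval b' (q i)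
  have hc : ∑ i ∈ s, aeval a (p i) * aeval b (q i) = c := by
    simp [c, a', b', Polynomial.aeval_subalgebra_coe]
  have hφ (φ : bicommutant ℂ {a, b} →ₐ[ℂ] ℂ) :
      φ c = ∑ i ∈ s, (p i).eval (φ a') * (q i).eval (φ b') := by
    simp [c, ← aeval_algHom_apply, coe_aeval_eq_eval]
  ext z
  rw [hc, mem_spectrum_coe_bicommutant_iff hab]
  constructor
  · rintro ⟨φ, rfl⟩
    exact ⟨(φ a', φ b'), (mem_jointSpectrum_iff hab).2 ⟨φ, rfl, rfl⟩, (hφ φ).symm⟩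
  · rintro ⟨⟨x, y⟩, hxy, rfl⟩
    obtain ⟨φ, rfl, rfl⟩ := (mem_jointSpectrum_iff hab).1 hxy
    exact ⟨φ, hφ φ⟩

end BanachAlgebra

section HilbertSpace

open scoped InnerProductSpace InnerProduct

variable {𝕜 E : Type*} [RCLike 𝕜] [NormedAddCommGroup E] [InnerProductSpace 𝕜 E] [CompleteSpace E]

theorem isUnit_adjoint_mul_self {T : E →L[𝕜] E} {ε : ℝ} (hε : 0 < ε)
    (hT : ∀ u, ε * ‖u‖ ≤ ‖T u‖) : IsUnit (T† * T) := by
  refine ContinuousLinearMap.isUnit_of_forall_le_norm_inner_map _ (c := ⟨ε ^ 2, by positivity⟩)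
    (by exact_mod_cast pow_pos hε 2) fun u => ?_
  calc ‖u‖ ^ 2 * ε ^ 2 = (ε * ‖u‖) ^ 2 := by ring
    _ ≤ ‖T u‖ ^ 2 := by gcongr; exact hT u
    _ = ‖⟪(T† * T) u, u⟫_𝕜‖ := by
      rw [mul_apply_eq_comp, ContinuousLinearMap.adjoint_inner_left, inner_self_eq_norm_sq_to_K]
      simp

theorem exists_norm_apply_le_or_norm_adjoint_apply_le {T : E →L[𝕜] E} (hT : ¬IsUnit T) {ε : ℝ}
    (hε : 0 < ε) : ∃ u ≠ 0, ‖T u‖ ≤ ε * ‖u‖ ∨ ‖(T†) u‖ ≤ ε * ‖u‖ := by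
  by_contra! h
  have hbound (u : E) : ε * ‖u‖ ≤ ‖T u‖ ∧ ε * ‖u‖ ≤ ‖(T†) u‖ := by
    rcases eq_or_ne u 0 with rfl | hu
    · simp
    · exact ⟨(h u hu).1.le, (h u hu).2.le⟩
  obtain ⟨X, hX⟩ := (isUnit_adjoint_mul_self hε fun u => (hbound u).1).exists_left_inv
  obtain ⟨Y, hY⟩ := (isUnit_adjoint_mul_self hε fun u => (hbound u).2).exists_right_inv
  rw [ContinuousLinearMap.adjoint_adjoint, mul_assoc] at hY
  rw [← mul_assoc] at hX
  exact hT (isUnit_iff_exists_and_exists.2 ⟨⟨_, hY⟩, ⟨_, hX⟩⟩)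

theorem norm_inner_mul_apply_le {S X : E →L[𝕜] E} (hSX : Commute S X) {w : E} {ε : ℝ}
    (hw : ‖S w‖ ≤ ε * ‖w‖ ∨ ‖(S†) w‖ ≤ ε * ‖w‖) :
    ‖⟪w, (S * X) w⟫_𝕜‖ ≤ ε * ‖X‖ * ‖w‖ ^ 2 := by
  rcases hw with hw | hw
  · calc ‖⟪w, (S * X) w⟫_𝕜‖ = ‖⟪w, X (S w)⟫_𝕜‖ := by rw [hSX.eq, mul_apply_eq_comp]
      _ ≤ ‖w‖ * ‖X (S w)‖ := norm_inner_le_norm _ _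
      _ ≤ ‖w‖ * (‖X‖ * (ε * ‖w‖)) := by gcongr; exact X.le_opNorm_of_le hw
      _ = ε * ‖X‖ * ‖w‖ ^ 2 := by ring
  · calc ‖⟪w, (S * X) w⟫_𝕜‖ = ‖⟪(S†) w, X w⟫_𝕜‖ := by
          rw [mul_apply_eq_comp, ContinuousLinearMap.adjoint_inner_left]
      _ ≤ ‖(S†) w‖ * ‖X w‖ := norm_inner_le_norm _ _
      _ ≤ (ε * ‖w‖) * (‖X‖ * ‖w‖) :=
        mul_le_mul hw (X.le_opNorm w) (norm_nonneg _) ((norm_nonneg _).trans hw)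
      _ = ε * ‖X‖ * ‖w‖ ^ 2 := by ring

theorem mul_add_mul_ne_one_of_forall_exists {S T X Y : E →L[𝕜] E} (hSX : Commute S X)
    (hTY : Commute T Y)
    (h : ∀ ε > 0, ∃ w ≠ 0, (‖S w‖ ≤ ε * ‖w‖ ∨ ‖(S†) w‖ ≤ ε * ‖w‖) ∧
      (‖T w‖ ≤ ε * ‖w‖ ∨ ‖(T†) w‖ ≤ ε * ‖w‖)) :
    S * X + T * Y ≠ 1 := by
  intro hone
  obtain ⟨w, hw, hS, hT⟩ := h (‖X‖ + ‖Y‖ + 1)⁻¹ (by positivity)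
  refine lt_irrefl (‖w‖ ^ 2) ?_
  calc ‖w‖ ^ 2 = ‖⟪w, (S * X + T * Y) w⟫_𝕜‖ := by
        rw [hone, one_apply_eq_self, inner_self_eq_norm_sq_to_K]
        simp
    _ ≤ ‖⟪w, (S * X) w⟫_𝕜‖ + ‖⟪w, (T * Y) w⟫_𝕜‖ := by
        rw [add_apply, inner_add_right]
        exact norm_add_le _ _
    _ ≤ (‖X‖ + ‖Y‖ + 1)⁻¹ * ‖X‖ * ‖w‖ ^ 2 + (‖X‖ + ‖Y‖ + 1)⁻¹ * ‖Y‖ * ‖w‖ ^ 2 :=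
        add_le_add (norm_inner_mul_apply_le hSX hS) (norm_inner_mul_apply_le hTY hT)
    _ = (‖X‖ + ‖Y‖) / (‖X‖ + ‖Y‖ + 1) * ‖w‖ ^ 2 := by ring
    _ < 1 * ‖w‖ ^ 2 := by
        gcongr
        exact (div_lt_one (by positivity)).2 (lt_add_one _)
    _ = ‖w‖ ^ 2 := one_mul _

end HilbertSpace

section TensorOp

open scoped InnerProduct

variable {H K : Type*} [NormedAddCommGroup H] [InnerProductSpace ℂ H]
  [NormedAddCommGroup K] [InnerProductSpace ℂ K]

theorem tensorOp_coe (A : H →L[ℂ] H) (B : K →L[ℂ] K) (w : H ⊗[ℂ] K) :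
    tensorOp A B (w : HilbertTensor H K) =
      ((TensorProduct.mapL A B w : H ⊗[ℂ] K) : HilbertTensor H K) :=
  ContinuousLinearMap.completion_apply_coe _ _

theorem continuousLinearMap_ext_tmul {S T : HilbertTensor H K →L[ℂ] HilbertTensor H K}
    (h : ∀ (u : H) (v : K), S ((u ⊗ₜ[ℂ] v : H ⊗[ℂ] K) : HilbertTensor H K) =
      T ((u ⊗ₜ[ℂ] v : H ⊗[ℂ] K) : HilbertTensor H K)) : S = T := by
  ext w
  induction w using UniformSpace.Completion.induction_on with
  | hp => exact isClosed_eq S.continuous T.continuous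
  | ih w =>
    induction w using TensorProduct.induction_on with
    | zero => rw [UniformSpace.Completion.coe_zero, map_zero, map_zero]
    | tmul u v => exact h u v
    | add w₁ w₂ h₁ h₂ => rw [UniformSpace.Completion.coe_add, map_add, map_add, h₁, h₂]

theorem tensorOp_mul (A A' : H →L[ℂ] H) (B B' : K →L[ℂ] K) :
    tensorOp (A * A') (B * B') = tensorOp A B * tensorOp A' B' :=
  continuousLinearMap_ext_tmul fun u v => by simp [tensorOp_coe_tmul]

theorem tensorOp_one_one : tensorOp (1 : H →L[ℂ] H) (1 : K →L[ℂ] K) = 1 :=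
  continuousLinearMap_ext_tmul fun u v => by simp [tensorOp_coe_tmul]

theorem tensorOp_one_right_mul_one_left (A : H →L[ℂ] H) (B : K →L[ℂ] K) :
    tensorOp A 1 * tensorOp 1 B = tensorOp A B := by
  rw [← tensorOp_mul, mul_one, one_mul]

theorem commute_tensorOp_one_right_one_left (A : H →L[ℂ] H) (B : K →L[ℂ] K) :
    Commute (tensorOp A (1 : K →L[ℂ] K)) (tensorOp (1 : H →L[ℂ] H) B) := by
  rw [Commute, SemiconjBy, ← tensorOp_mul, ← tensorOp_mul, mul_one, one_mul, mul_one, one_mul]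

variable (H K) in
/-- The ampliation `A ↦ A ⊗ 1` as a homomorphism of algebras, so that it is compatible with spectra
and with polynomials. -/
noncomputable def leftAmpliation :
    (H →L[ℂ] H) →ₐ[ℂ] (HilbertTensor H K →L[ℂ] HilbertTensor H K) :=
  AlgHom.ofLinearMap
    { toFun := fun A => tensorOp A 1
      map_add' := fun A A' => continuousLinearMap_ext_tmul fun u v => by
        simp [tensorOp_coe_tmul, TensorProduct.add_tmul, UniformSpace.Completion.coe_add]
      map_smul' := fun r A => continuousLinearMap_ext_tmul fun u v => by
        simp [tensorOp_coe_tmul, ← TensorProduct.smul_tmul'] }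
    tensorOp_one_one fun A A' => by simp [← tensorOp_mul]

variable (H K) in
/-- The ampliation `B ↦ 1 ⊗ B` as a homomorphism of algebras, so that it is compatible with spectra
and with polynomials. -/
noncomputable def rightAmpliation :
    (K →L[ℂ] K) →ₐ[ℂ] (HilbertTensor H K →L[ℂ] HilbertTensor H K) :=
  AlgHom.ofLinearMap
    { toFun := fun B => tensorOp 1 B
      map_add' := fun B B' => continuousLinearMap_ext_tmul fun u v => by
        simp [tensorOp_coe_tmul, TensorProduct.tmul_add, UniformSpace.Completion.coe_add]
      map_smul' := fun r B => continuousLinearMap_ext_tmul fun u v => by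
        simp [tensorOp_coe_tmul] }
    tensorOp_one_one fun B B' => by simp [← tensorOp_mul]

theorem tensorOp_aeval (A : H →L[ℂ] H) (B : K →L[ℂ] K) (p q : ℂ[X]) :
    tensorOp (aeval A p) (aeval B q) =
      aeval (tensorOp A (1 : K →L[ℂ] K)) p * aeval (tensorOp (1 : H →L[ℂ] H) B) q := by
  rw [← tensorOp_one_right_mul_one_left]
  exact congrArg₂ (· * ·) (aeval_algHom_apply (leftAmpliation H K) A p).symm
    (aeval_algHom_apply (rightAmpliation H K) B q).symm

theorem norm_coe_tmul (u : H) (v : K) :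
    ‖((u ⊗ₜ[ℂ] v : H ⊗[ℂ] K) : HilbertTensor H K)‖ = ‖u‖ * ‖v‖ := by
  rw [UniformSpace.Completion.norm_coe, TensorProduct.norm_tmul]

theorem norm_tensorOp_one_right_le {A : H →L[ℂ] H} {u : H} {ε : ℝ} (hA : ‖A u‖ ≤ ε * ‖u‖) (v : K) :
    ‖tensorOp A 1 ((u ⊗ₜ[ℂ] v : H ⊗[ℂ] K) : HilbertTensor H K)‖ ≤
      ε * ‖((u ⊗ₜ[ℂ] v : H ⊗[ℂ] K) : HilbertTensor H K)‖ := by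
  rw [tensorOp_coe_tmul, norm_coe_tmul, norm_coe_tmul, one_apply_eq_self, ← mul_assoc]
  gcongr

theorem norm_tensorOp_one_left_le {B : K →L[ℂ] K} {v : K} {ε : ℝ} (hB : ‖B v‖ ≤ ε * ‖v‖) (u : H) :
    ‖tensorOp 1 B ((u ⊗ₜ[ℂ] v : H ⊗[ℂ] K) : HilbertTensor H K)‖ ≤
      ε * ‖((u ⊗ₜ[ℂ] v : H ⊗[ℂ] K) : HilbertTensor H K)‖ := by
  rw [tensorOp_coe_tmul, norm_coe_tmul, norm_coe_tmul, one_apply_eq_self, mul_left_comm]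
  gcongr

variable [CompleteSpace H] [CompleteSpace K]

theorem adjoint_tensorOp (A : H →L[ℂ] H) (B : K →L[ℂ] K) :
    (tensorOp A B)† = tensorOp (A†) (B†) := by
  refine ((ContinuousLinearMap.eq_adjoint_iff _ _).2 fun x y => ?_).symm
  induction x, y using UniformSpace.Completion.induction_on₂ with
  | hp => exact isClosed_eq (by fun_prop) (by fun_prop)
  | ih x y =>
    simp only [tensorOp_coe, UniformSpace.Completion.inner_coe]
    induction x using TensorProduct.induction_on with
    | zero => simp
    | add x₁ x₂ h₁ h₂ => simp only [map_add, inner_add_left, h₁, h₂]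
    | tmul u v =>
      induction y using TensorProduct.induction_on with
      | zero => simp
      | add y₁ y₂ h₁ h₂ => simp only [map_add, inner_add_right, h₁, h₂]
      | tmul u' v' => simp [ContinuousLinearMap.adjoint_inner_left]

theorem exists_norm_tensorOp_apply_le {A : H →L[ℂ] H} {B : K →L[ℂ] K} (hA : ¬IsUnit A)
    (hB : ¬IsUnit B) {ε : ℝ} (hε : 0 < ε) :
    ∃ w : HilbertTensor H K, w ≠ 0 ∧
      (‖tensorOp A 1 w‖ ≤ ε * ‖w‖ ∨ ‖((tensorOp A 1)†) w‖ ≤ ε * ‖w‖) ∧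
      (‖tensorOp 1 B w‖ ≤ ε * ‖w‖ ∨ ‖((tensorOp 1 B)†) w‖ ≤ ε * ‖w‖) := by
  obtain ⟨u, hu, hAu⟩ := exists_norm_apply_le_or_norm_adjoint_apply_le hA hε
  obtain ⟨v, hv, hBv⟩ := exists_norm_apply_le_or_norm_adjoint_apply_le hB hε
  have hw : ((u ⊗ₜ[ℂ] v : H ⊗[ℂ] K) : HilbertTensor H K) ≠ 0 := by
    rw [← norm_ne_zero_iff, norm_coe_tmul]
    positivity
  refine ⟨_, hw, ?_⟩
  rw [adjoint_tensorOp, adjoint_tensorOp, ← ContinuousLinearMap.star_eq_adjoint (1 : H →L[ℂ] H),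
    ← ContinuousLinearMap.star_eq_adjoint (1 : K →L[ℂ] K), star_one, star_one]
  exact ⟨hAu.imp (norm_tensorOp_one_right_le · v) (norm_tensorOp_one_right_le · v),
    hBv.imp (norm_tensorOp_one_left_le · u) (norm_tensorOp_one_left_le · u)⟩

theorem jointSpectrum_tensorOp (A : H →L[ℂ] H) (B : K →L[ℂ] K) :
    jointSpectrum ℂ (tensorOp A (1 : K →L[ℂ] K)) (tensorOp (1 : H →L[ℂ] H) B) =
      spectrum ℂ A ×ˢ spectrum ℂ B := by
  have hcomm := commute_tensorOp_one_right_one_left A B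
  refine Set.Subset.antisymm ?_ ?_
  · exact (jointSpectrum_subset_prod _ _).trans
      (Set.prod_mono (AlgHom.spectrum_apply_subset (leftAmpliation H K) A)
        (AlgHom.spectrum_apply_subset (rightAmpliation H K) B))
  · rintro ⟨x, y⟩ ⟨hx, hy⟩ c hc d hd
    have hA : ¬IsUnit (A - algebraMap ℂ _ x) := by rwa [← IsUnit.neg_iff, neg_sub]
    have hB : ¬IsUnit (B - algebraMap ℂ _ y) := by rwa [← IsUnit.neg_iff, neg_sub]
    refine mul_add_mul_ne_one_of_forall_exists
      ((commute_left_of_mem_bicommutant hcomm hc).sub_left (Algebra.commutes x c))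
      ((commute_right_of_mem_bicommutant hcomm hd).sub_left (Algebra.commutes y d)) ?_
    have hleft : tensorOp (A - algebraMap ℂ _ x) (1 : K →L[ℂ] K) =
        tensorOp A 1 - algebraMap ℂ _ x :=
      (map_sub (leftAmpliation H K) A _).trans (congrArg _ (AlgHom.commutes _ x))
    have hright : tensorOp (1 : H →L[ℂ] H) (B - algebraMap ℂ _ y) =
        tensorOp 1 B - algebraMap ℂ _ y :=
      (map_sub (rightAmpliation H K) B _).trans (congrArg _ (AlgHom.commutes _ y))
    rw [← hleft, ← hright]
    exact fun ε hε => exists_norm_tensorOp_apply_le hA hB hε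

end TensorOp

theorem image2_spectrum_eq_image_ofReal {R S : Type*} [CStarAlgebra R] [CStarAlgebra S] {a : R}
    {b : S} (ha : IsSelfAdjoint a) (hb : IsSelfAdjoint b) {f : ℂ → ℂ → ℂ} {g : ℝ → ℝ → ℝ}
    (hfg : ∀ x y : ℝ, f x y = g x y) :
    Set.image2 f (spectrum ℂ a) (spectrum ℂ b) = ((↑) : ℝ → ℂ) '' {z : ℝ | ∃ x y : ℝ,
      (x : ℂ) ∈ spectrum ℂ a ∧ (y : ℂ) ∈ spectrum ℂ b ∧ z = g x y} := by
  ext z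
  constructor
  · rintro ⟨x, hx, y, hy, rfl⟩
    have hxre := ha.mem_spectrum_eq_re hx
    have hyre := hb.mem_spectrum_eq_re hy
    rw [hxre] at hx ⊢
    rw [hyre] at hy ⊢
    exact ⟨_, ⟨x.re, y.re, hx, hy, rfl⟩, (hfg _ _).symm⟩
  · rintro ⟨_, ⟨x, y, hx, hy, rfl⟩, rfl⟩
    exact ⟨x, hx, y, hy, hfg x y⟩

theorem proposition2_general {H K : Type*}
    [NormedAddCommGroup H] [InnerProductSpace ℂ H] [CompleteSpace H]
    [NormedAddCommGroup K] [InnerProductSpace ℂ K] [CompleteSpace K]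
    (A : H →L[ℂ] H) (B : K →L[ℂ] K) {ι : Type*} (s : Finset ι) (p q : ι → ℂ[X]) :
    spectrum ℂ (∑ i ∈ s, tensorOp (aeval A (p i)) (aeval B (q i))) =
      Set.image2 (fun x y => ∑ i ∈ s, (p i).eval x * (q i).eval y)
        (spectrum ℂ A) (spectrum ℂ B) := by
  simp only [tensorOp_aeval]
  rw [spectrum_sum_aeval_mul_aeval (R := HilbertTensor H K →L[ℂ] HilbertTensor H K)
    (commute_tensorOp_one_right_one_left A B), jointSpectrum_tensorOp, ← Set.image_prod]

theorem proposition2 {H K : Type*}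
    [NormedAddCommGroup H] [InnerProductSpace ℂ H] [CompleteSpace H]
    [NormedAddCommGroup K] [InnerProductSpace ℂ K] [CompleteSpace K]
    (A : H →L[ℂ] H) (B : K →L[ℂ] K) (hA : IsSelfAdjoint A) (hB : IsSelfAdjoint B) :
    spectrum ℂ (tensorOp A (1 : K →L[ℂ] K) + tensorOp (1 : H →L[ℂ] H) B) =
        ((↑) : ℝ → ℂ) '' {z : ℝ | ∃ x y : ℝ,
          (x : ℂ) ∈ spectrum ℂ A ∧ (y : ℂ) ∈ spectrum ℂ B ∧ z = x + y} ∧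
      spectrum ℂ (tensorOp A B) =
        ((↑) : ℝ → ℂ) '' {z : ℝ | ∃ x y : ℝ,
          (x : ℂ) ∈ spectrum ℂ A ∧ (y : ℂ) ∈ spectrum ℂ B ∧ z = x * y} ∧
      spectrum ℂ (tensorOp A (1 : K →L[ℂ] K) + tensorOp (1 : H →L[ℂ] H) B + tensorOp A B) =
        ((↑) : ℝ → ℂ) '' {z : ℝ | ∃ x y : ℝ,
          (x : ℂ) ∈ spectrum ℂ A ∧ (y : ℂ) ∈ spectrum ℂ B ∧ z = x + y + x * y} := by
  have h {n : ℕ} (p q : Fin n → ℂ[X]) {g : ℝ → ℝ → ℝ} hg :=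
    (proposition2_general A B Finset.univ p q).trans
      (image2_spectrum_eq_image_ofReal (g := g) hA hB hg)
  refine ⟨?_, ?_, ?_⟩
  · simpa [Fin.sum_univ_two] using h ![X, 1] ![1, X] (g := (· + ·)) (by simp [Fin.sum_univ_two])
  · simpa using h ![X] ![X] (g := (· * ·)) (by simp)
  · simpa [Fin.sum_univ_three] using h ![X, 1, X] ![1, X, X] (g := fun x y => x + y + x * y)
      (by simp [Fin.sum_univ_three])
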